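/- **Theorem 1.2 (complex Borel–Bernstein theorem).** For $z\in\mathbb{C}$ put $[z]=\lfloor \operatorname{Re} z+\tfrac12\rfloor+i\lfloor \operatorname{Im} z+\tfrac12\rfloor\in\mathbb{Z}[i]$, let $\mathfrak{F}=\{z\in\mathbb{C}:[z]=0\}$, and let $T:\mathfrak{F}\to\mathfrak{F}$ be given by $T(0)=0$ and $T(z)=\tfrac1z-\left[\tfrac1z\right]$ for $z\neq 0$. The Hurwitz continued fraction digits of $z\in\mathfrak{F}$ are $a_n(z)=\left[1/T^{n-1}(z)\right]$, defined for those $n\ge 1$ with $T^{n-1}(z)\neq 0$. Let $u=(u_n)_{n\ge1}$ be a sequence of positive real numbers and let $$E(u)=\{z\in\mathfrak{F}:\ a_n(z)\text{ is defined and } |a_n(z)|\ge u_n\text{ for infinitely many } n\ge 1\}.$$ Then $E(u)$ is a Borel set and, writing $\mathfrak{m}$ for two-dimensional Lebesgue measure on $\mathfrak{F}$, $$\mathfrak{m}(E(u))=\begin{cases}0,&\text{if }\sum_{n\ge1}u_n^{-2}<+\infty,\\[2pt] 1,&\text{if }\sum_{n\ge1}u_n^{-2}=+\infty.\end{cases}$$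 -/

import Mathlib

namespace HurwitzCF

noncomputable section

/-- The nearest Gaussian integer `[z] = ⌊Re z + 1/2⌋ + i ⌊Im z + 1/2⌋`. -/
def nearest (z : ℂ) : GaussianInt :=
  ⟨⌊z.re + 1 / 2⌋, ⌊z.im + 1 / 2⌋⟩

/-- The unit square `𝔉 = {z : [z] = 0}`. -/
def square : Set ℂ := {z | nearest z = 0}

/-- The Hurwitz map `T z = 1/z - [1/z]` for `z ≠ 0` and `T 0 = 0`. It is used on `𝔉` only,
which it maps into itself. -/
def T (z : ℂ) : ℂ :=
  if z = 0 then 0 else z⁻¹ - (nearest z⁻¹ : ℂ)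

/-- The point `T^n (z - [z])`, which lies in `𝔉`. -/
def remainder (z : ℂ) (n : ℕ) : ℂ := T^[n] (z - (nearest z : ℂ))

/-- `z` has a Hurwitz digit `a_n(z)`: always for `n = 0`, and for `n ≥ 1` if and only if
`T^(n-1) (z - [z]) ≠ 0`. -/
def HasDigit (z : ℂ) : ℕ → Prop
  | 0 => True
  | n + 1 => remainder z n ≠ 0

/-- The Hurwitz digits `a_0(z) = [z]` and `a_n(z) = [1 / T^(n-1) (z - [z])]` for `n ≥ 1`,
meaningful when `HasDigit z n` holds. -/
def digit (z : ℂ) : ℕ → GaussianInt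
  | 0 => nearest z
  | n + 1 => nearest (remainder z n)⁻¹

/-- `E(u)`: the `z ∈ 𝔉` such that `|a_n(z)| ≥ u_n` for infinitely many `n ≥ 1` (for which
the digit `a_n(z)` is defined). -/
def E (u : ℕ+ → ℝ) : Set ℂ :=
  {z | z ∈ square ∧ {n : ℕ+ | HasDigit z n ∧ u n ≤ ‖(digit z n : ℂ)‖}.Infinite}

end

end HurwitzCF

open MeasureTheory Filter Topology
open scoped ENNReal

namespace HurwitzCF

noncomputable section

/-! The obstacle is that `T` does not map each first-digit cell onto the whole square. But if the
cell is cut from a region (the open square minus unit discs about some lattice neighbours of 0), its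
image is, up to a null set, again such a region or empty: inversion carries the bounding lines and
circles to lattice lines and unit circles about lattice points (`branchDomain_eq`). No region that
arises omits the discs about two opposite units, so each keeps a fixed corner square at 0
(`exists_corner_subset_region`).

Lebesgue measure transported along the inverse branches has a density with log-Lipschitz constant 8,
whatever the digits (`LogLip.pull_le`). Hence, given any initial digits, the next one has modulus at
least `u` with conditional probability comparable to `u⁻²`, uniformly for `u ≥ 1`: this event is
essentially a disc of radius `1/u` about 0. Such conditional bounds multiply
(`setLIntegral_digitEvent_le`) and replace independence in both halves of Borel–Cantelli. -/

/-! ### Regions and their images under the branches of `T` -/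

/-- The open unit square with the closed unit discs about the points of `Ω` removed. -/
def region (Ω : Set GaussianInt) : Set ℂ :=
  {w | |w.re| < 1 / 2 ∧ |w.im| < 1 / 2 ∧
    ∀ ω ∈ Ω, 1 < (w.re - ω.re) ^ 2 + (w.im - ω.im) ^ 2}

/-- `Ω` consists of neighbours of `0` in the square lattice, and contains no two opposite units. -/
structure Admissible (Ω : Set GaussianInt) : Prop where
  abs_re_le : ∀ ω ∈ Ω, |ω.re| ≤ 1
  abs_im_le : ∀ ω ∈ Ω, |ω.im| ≤ 1
  zero_notMem : (0 : GaussianInt) ∉ Ω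
  not_opposite_re : ¬ ((⟨1, 0⟩ : GaussianInt) ∈ Ω ∧ (⟨-1, 0⟩ : GaussianInt) ∈ Ω)
  not_opposite_im : ¬ ((⟨0, 1⟩ : GaussianInt) ∈ Ω ∧ (⟨0, -1⟩ : GaussianInt) ∈ Ω)

theorem admissible_empty : Admissible ∅ := by
  constructor <;> simp

/-- The centres of the discs missing from the image under `T` of the points of `region Ω` whose
first digit is `a`. -/
def next (Ω : Set GaussianInt) (a : GaussianInt) : Set GaussianInt :=
  {ω | |ω.re| ≤ 1 ∧ |ω.im| ≤ 1 ∧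
    ((ω.re + a.re) ^ 2 + (ω.im + a.im) ^ 2 = 1 ∨
      (ω.re + a.re) ^ 2 + (ω.im + a.im) ^ 2 = 2 ∧
        (⟨ω.re + a.re, -(ω.im + a.im)⟩ : GaussianInt) ∈ Ω)}

theorem normSq_pos_of_ne {v : ℂ} (hv : v ≠ 0) : 0 < v.re ^ 2 + v.im ^ 2 := by
  have := Complex.normSq_pos.2 hv
  rw [Complex.normSq_apply] at this
  nlinarith

/-- Inversion sends the sides of the square to unit circles about ±1 and ±i. A circle about a unit ω
passes through 0 and becomes a line, the quadratic term vanishing; for |ω|² = 2 it becomes the unit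
circle about the conjugate of ω. -/
theorem inv_mem_region_iff {Ω : Set GaussianInt} {v : ℂ} (hv : v ≠ 0) :
    v⁻¹ ∈ region Ω ↔ 2 * |v.re| < v.re ^ 2 + v.im ^ 2 ∧ 2 * |v.im| < v.re ^ 2 + v.im ^ 2 ∧
      ∀ ω ∈ Ω, 0 < 1 - 2 * (ω.re * v.re - ω.im * v.im) +
        (ω.re ^ 2 + ω.im ^ 2 - 1 : ℝ) * (v.re ^ 2 + v.im ^ 2) := by
  have hN := normSq_pos_of_ne hv
  have hsq : Complex.normSq v = v.re ^ 2 + v.im ^ 2 := by rw [Complex.normSq_apply]; ring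
  simp only [region, Set.mem_ofPred_eq, Complex.inv_re, Complex.inv_im, hsq]
  set N := v.re ^ 2 + v.im ^ 2 with hNdef
  refine and_congr ?_ (and_congr ?_ (forall₂_congr fun ω _ => ?_))
  · rw [abs_div, abs_of_pos hN, div_lt_div_iff₀ hN two_pos]
    constructor <;> intro h <;> linarith
  · rw [abs_div, abs_neg, abs_of_pos hN, div_lt_div_iff₀ hN two_pos]
    constructor <;> intro h <;> linarith
  · have key : (v.re / N - ω.re) ^ 2 + (-v.im / N - ω.im) ^ 2 - 1 =
        (1 - 2 * (ω.re * v.re - ω.im * v.im) + (ω.re ^ 2 + ω.im ^ 2 - 1 : ℝ) * N) / N := by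
      have : v.re ^ 2 = N - v.im ^ 2 := by rw [hNdef]; ring
      field_simp
      ring_nf
      rw [this]; ring
    rw [← sub_pos, key]
    exact ⟨fun h => by simpa [hN] using (div_pos_iff_of_pos_right hN).1 h, fun h => div_pos h hN⟩

theorem two_lt_normSq {Ω : Set GaussianInt} {v : ℂ} (hv : v ≠ 0) (h : v⁻¹ ∈ region Ω) :
    2 < v.re ^ 2 + v.im ^ 2 := by
  obtain ⟨h1, h2, -⟩ := (inv_mem_region_iff hv).1 h
  have hN := normSq_pos_of_ne hv
  set N := v.re ^ 2 + v.im ^ 2 with hNdef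
  have a1 : (2 * |v.re|) ^ 2 < N ^ 2 := pow_lt_pow_left₀ h1 (by positivity) two_ne_zero
  have a2 : (2 * |v.im|) ^ 2 < N ^ 2 := pow_lt_pow_left₀ h2 (by positivity) two_ne_zero
  rw [mul_pow, sq_abs] at a1 a2
  nlinarith

/-- The part of the open square mapped into `region Ω` by the inverse branch `w ↦ 1 / (a + w)`. -/
def branchDomain (Ω : Set GaussianInt) (a : GaussianInt) : Set ℂ :=
  {w | |w.re| < 1 / 2 ∧ |w.im| < 1 / 2 ∧ (a + w : ℂ) ≠ 0 ∧ (a + w : ℂ)⁻¹ ∈ region Ω}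

theorem digit_ne_zero_of_mem {Ω : Set GaussianInt} {a : GaussianInt} {w : ℂ}
    (hw : w ∈ branchDomain Ω a) : a ≠ 0 := by
  rintro rfl
  obtain ⟨h1, h2, h3, h4⟩ := hw
  have := two_lt_normSq h3 h4
  simp only [map_zero, zero_add] at this
  rw [← sq_abs w.re, ← sq_abs w.im] at this
  nlinarith [abs_nonneg w.re, abs_nonneg w.im]

/-- In `next`, the centres at norm 1 from the origin, after translation by `a`, come from the sides
of the square; those at norm 2 come from the discs of `Ω`, conjugated by inversion. -/
theorem branchDomain_subset (Ω : Set GaussianInt) (a : GaussianInt) :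
    branchDomain Ω a ⊆ region (next Ω a) := by
  rintro w ⟨h1, h2, h3, h4⟩
  refine ⟨h1, h2, ?_⟩
  obtain ⟨k1, k2, k3⟩ := (inv_mem_region_iff h3).1 h4
  rintro ω ⟨-, -, h⟩
  simp only [Complex.add_re, Complex.add_im, ← GaussianInt.intCast_re,
    ← GaussianInt.intCast_im] at k1 k2 k3
  obtain ⟨p, hp⟩ : ∃ p, p = ω.re + a.re := ⟨_, rfl⟩
  obtain ⟨q, hq⟩ : ∃ q, q = ω.im + a.im := ⟨_, rfl⟩
  have hp' : (ω.re : ℝ) = p - a.re := by rw [hp]; push_cast; ring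
  have hq' : (ω.im : ℝ) = q - a.im := by rw [hq]; push_cast; ring
  rw [← hp, ← hq] at h
  rw [hp', hq']
  rcases h with h | ⟨h, hΩ⟩
  · have e : p = 1 ∧ q = 0 ∨ p = -1 ∧ q = 0 ∨ p = 0 ∧ q = 1 ∨ p = 0 ∧ q = -1 := by
      have : p ≤ 1 := by nlinarith
      have : -1 ≤ p := by nlinarith
      have : q ≤ 1 := by nlinarith
      have : -1 ≤ q := by nlinarith
      clear hp hq hp' hq'
      interval_cases p <;> interval_cases q <;> simp_all
    have := le_abs_self (a.re + w.re : ℝ)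
    have := neg_le_abs (a.re + w.re : ℝ)
    have := le_abs_self (a.im + w.im : ℝ)
    have := neg_le_abs (a.im + w.im : ℝ)
    rcases e with ⟨rfl, rfl⟩ | ⟨rfl, rfl⟩ | ⟨rfl, rfl⟩ | ⟨rfl, rfl⟩ <;> push_cast <;> nlinarith
  · have := k3 _ hΩ
    have h' : (p : ℝ) ^ 2 + (q : ℝ) ^ 2 = 2 := by exact_mod_cast h
    push_cast at this
    have e : (p : ℝ) ^ 2 + (-(q : ℝ)) ^ 2 - 1 = 1 := by linarith
    rw [e] at this
    nlinarith

theorem zero_notMem_next {Ω : Set GaussianInt} {a : GaussianInt}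
    (hne : (branchDomain Ω a).Nonempty) : (0 : GaussianInt) ∉ next Ω a := by
  obtain ⟨w, hw⟩ := hne
  intro h0
  obtain ⟨h1, h2, h3⟩ := branchDomain_subset Ω a hw
  have := h3 _ h0
  simp only [Zsqrtd.re_zero, Zsqrtd.im_zero, Int.cast_zero, sub_zero] at this
  rw [← sq_abs w.re, ← sq_abs w.im] at this
  nlinarith [abs_nonneg w.re, abs_nonneg w.im]

/-- For two opposite real units the squared distances lie in {1, 2} and differ by `4 * a.re`, so
`a.re = 0` and `a` is a unit. Then 0 itself would be a centre, and its disc covers the square. The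
imaginary case is the same. -/
theorem admissible_next {Ω : Set GaussianInt} {a : GaussianInt}
    (hne : (branchDomain Ω a).Nonempty) : Admissible (next Ω a) := by
  have h0 := zero_notMem_next hne
  have ha : a ≠ 0 := digit_ne_zero_of_mem hne.some_mem
  have hnorm : a.re ^ 2 + a.im ^ 2 ≠ 1 := fun h => h0 (by simp [next, h])
  refine ⟨fun ω h => h.1, fun ω h => h.2.1, h0, ?_, ?_⟩
  · rintro ⟨⟨-, -, h⟩, ⟨-, -, h'⟩⟩
    simp only at h h'
    have hre : a.re = 0 := by
      rcases h with h | ⟨h, -⟩ <;> rcases h' with h' | ⟨h', -⟩ <;> ring_nf at h h' <;> omega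
    have him : a.im ≠ 0 := fun him => ha (Zsqrtd.ext hre him)
    have : a.im ^ 2 ≤ 1 := by
      rw [hre] at h
      rcases h with h | ⟨h, -⟩ <;> linarith
    have : 0 < a.im ^ 2 := by positivity
    rw [hre] at hnorm
    omega
  · rintro ⟨⟨-, -, h⟩, ⟨-, -, h'⟩⟩
    simp only at h h'
    have him : a.im = 0 := by
      rcases h with h | ⟨h, -⟩ <;> rcases h' with h' | ⟨h', -⟩ <;> ring_nf at h h' <;> omega
    have hre : a.re ≠ 0 := fun hre => ha (Zsqrtd.ext hre him)
    have : a.re ^ 2 ≤ 1 := by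
      rw [him] at h
      rcases h with h | ⟨h, -⟩ <;> linarith
    have : 0 < a.re ^ 2 := by positivity
    rw [him] at hnorm
    omega

/-- A unit disc about a lattice point that is not a neighbour of `0` does not meet the square. -/
theorem one_lt_of_not_neighbour {w : ℂ} (h1 : |w.re| < 1 / 2) (h2 : |w.im| < 1 / 2) {p q : ℤ}
    (h : ¬ (|p| ≤ 1 ∧ |q| ≤ 1)) : 1 < (w.re - p) ^ 2 + (w.im - q) ^ 2 := by
  rw [abs_lt] at h1 h2
  rw [not_and_or, not_le, not_le, lt_abs, lt_abs] at h
  rcases h with (h | h) | (h | h)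
  · have : (2 : ℝ) ≤ p := by exact_mod_cast (by omega : (2 : ℤ) ≤ p)
    nlinarith [sq_nonneg (w.im - q)]
  · have : (p : ℝ) ≤ -2 := by exact_mod_cast (by omega : p ≤ -2)
    nlinarith [sq_nonneg (w.im - q)]
  · have : (2 : ℝ) ≤ q := by exact_mod_cast (by omega : (2 : ℤ) ≤ q)
    nlinarith [sq_nonneg (w.re - p)]
  · have : (q : ℝ) ≤ -2 := by exact_mod_cast (by omega : q ≤ -2)
    nlinarith [sq_nonneg (w.re - p)]

theorem region_next_subset {Ω : Set GaussianInt} (hΩ : Admissible Ω) {a : GaussianInt}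
    (hne : (branchDomain Ω a).Nonempty) : region (next Ω a) ⊆ branchDomain Ω a := by
  obtain ⟨w₀, hw₀⟩ := hne
  have ha : a ≠ 0 := digit_ne_zero_of_mem hw₀
  rintro w ⟨h1, h2, h3⟩
  have disc : ∀ p q : ℤ, (p ^ 2 + q ^ 2 = 1 ∨ p ^ 2 + q ^ 2 = 2 ∧ (⟨p, -q⟩ : GaussianInt) ∈ Ω) →
      1 < (a.re + w.re - p) ^ 2 + (a.im + w.im - q) ^ 2 := by
    intro p q hpq
    have : 1 < (w.re - (p - a.re : ℤ)) ^ 2 + (w.im - (q - a.im : ℤ)) ^ 2 := by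
      by_cases hn : |p - a.re| ≤ 1 ∧ |q - a.im| ≤ 1
      · exact h3 ⟨p - a.re, q - a.im⟩ ⟨hn.1, hn.2, by simpa using hpq⟩
      · exact one_lt_of_not_neighbour h1 h2 hn
    push_cast at this
    convert this using 2 <;> ring
  have hv : (a + w : ℂ) ≠ 0 := by
    intro h
    apply ha
    have e1 := congrArg Complex.re h
    have e2 := congrArg Complex.im h
    simp only [Complex.add_re, Complex.add_im, ← GaussianInt.intCast_re,
      ← GaussianInt.intCast_im, Complex.zero_re, Complex.zero_im] at e1 e2
    rw [abs_lt] at h1 h2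
    have b1 : (a.re : ℝ) < 1 := by linarith
    have b2 : (-1 : ℝ) < a.re := by linarith
    have b3 : (a.im : ℝ) < 1 := by linarith
    have b4 : (-1 : ℝ) < a.im := by linarith
    have c1 : a.re < 1 := by exact_mod_cast b1
    have c2 : -1 < a.re := by exact_mod_cast b2
    have c3 : a.im < 1 := by exact_mod_cast b3
    have c4 : -1 < a.im := by exact_mod_cast b4
    exact Zsqrtd.ext (by simp; omega) (by simp; omega)
  refine ⟨h1, h2, hv, (inv_mem_region_iff hv).2 ?_⟩
  obtain ⟨g1, g2, g3, g4⟩ := hw₀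
  obtain ⟨-, -, k3⟩ := (inv_mem_region_iff g3).1 g4
  simp only [Complex.add_re, Complex.add_im, ← GaussianInt.intCast_re,
    ← GaussianInt.intCast_im] at k3 ⊢
  refine ⟨?_, ?_, ?_⟩
  · have d1 := disc 1 0 (Or.inl (by norm_num))
    have d2 := disc (-1) 0 (Or.inl (by norm_num))
    push_cast at d1 d2
    rcases abs_cases (a.re + w.re : ℝ) with ⟨e, -⟩ | ⟨e, -⟩ <;> rw [e] <;> nlinarith
  · have d1 := disc 0 1 (Or.inl (by norm_num))
    have d2 := disc 0 (-1) (Or.inl (by norm_num))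
    push_cast at d1 d2
    rcases abs_cases (a.im + w.im : ℝ) with ⟨e, -⟩ | ⟨e, -⟩ <;> rw [e] <;> nlinarith
  · rintro ⟨p, q⟩ hω
    have b1 := abs_le.1 (hΩ.abs_re_le _ hω)
    have b2 := abs_le.1 (hΩ.abs_im_le _ hω)
    have b0 : ¬ (p = 0 ∧ q = 0) := by
      rintro ⟨rfl, rfl⟩
      exact hΩ.zero_notMem hω
    simp only at b1 b2
    have hk := k3 _ hω
    simp only at hk ⊢
    rw [abs_lt] at h1 h2 g1 g2
    have hcase : p ^ 2 + q ^ 2 = 1 ∨ p ^ 2 + q ^ 2 = 2 := by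
      obtain ⟨b1, b1'⟩ := b1
      obtain ⟨b2, b2'⟩ := b2
      interval_cases p <;> interval_cases q <;> simp_all
    rcases hcase with hn | hn
    -- The inverted circle is a line along cell sides, so it does not cross the cell of `a`; the one
    -- point `w₀` decides the side for the whole cell.
    · have hn' : (p : ℝ) ^ 2 + (q : ℝ) ^ 2 = 1 := by exact_mod_cast hn
      rw [hn'] at hk ⊢
      have e : p = 1 ∧ q = 0 ∨ p = -1 ∧ q = 0 ∨ p = 0 ∧ q = 1 ∨ p = 0 ∧ q = -1 := by
        obtain ⟨b1, b1'⟩ := b1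
        obtain ⟨b2, b2'⟩ := b2
        interval_cases p <;> interval_cases q <;> simp_all
      rcases e with ⟨rfl, rfl⟩ | ⟨rfl, rfl⟩ | ⟨rfl, rfl⟩ | ⟨rfl, rfl⟩ <;> push_cast at hk ⊢
      · have : (a.re : ℝ) < 1 := by linarith
        have : a.re < 1 := by exact_mod_cast this
        have : (a.re : ℝ) ≤ 0 := by exact_mod_cast (by omega : a.re ≤ 0)
        linarith
      · have : (-1 : ℝ) < a.re := by linarith
        have : -1 < a.re := by exact_mod_cast this
        have : (0 : ℝ) ≤ a.re := by exact_mod_cast (by omega : 0 ≤ a.re)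
        linarith
      · have : (-1 : ℝ) < a.im := by linarith
        have : -1 < a.im := by exact_mod_cast this
        have : (0 : ℝ) ≤ a.im := by exact_mod_cast (by omega : 0 ≤ a.im)
        linarith
      · have : (a.im : ℝ) < 1 := by linarith
        have : a.im < 1 := by exact_mod_cast this
        have : (a.im : ℝ) ≤ 0 := by exact_mod_cast (by omega : a.im ≤ 0)
        linarith
    · have d := disc p (-q) (Or.inr ⟨by rw [neg_sq]; exact hn, by simpa using hω⟩)
      have hn' : (p : ℝ) ^ 2 + (q : ℝ) ^ 2 = 2 := by exact_mod_cast hn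
      push_cast at d
      rw [hn']
      nlinarith

theorem branchDomain_eq {Ω : Set GaussianInt} (hΩ : Admissible Ω) {a : GaussianInt}
    (hne : (branchDomain Ω a).Nonempty) : branchDomain Ω a = region (next Ω a) :=
  (branchDomain_subset Ω a).antisymm (region_next_subset hΩ hne)

/-- A region with admissible `Ω` contains a small square with a corner at `0`. -/
theorem exists_corner_subset_region {Ω : Set GaussianInt} (hΩ : Admissible Ω) :
    ∃ σ τ : ℝ, |σ| = 1 ∧ |τ| = 1 ∧ ∀ w : ℂ, 0 < σ * w.re → σ * w.re < 1 / 4 →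
      0 < τ * w.im → τ * w.im < 1 / 4 → w ∈ region Ω := by
  -- The corner points away from any removed unit disc. Discs about diagonal neighbours stay clear
  -- because 2 · (3/4)² > 1.
  obtain ⟨σ, hσ, hσ1, hσ2⟩ : ∃ σ : ℝ, (σ = 1 ∨ σ = -1) ∧
      ((⟨1, 0⟩ : GaussianInt) ∈ Ω → σ = -1) ∧ ((⟨-1, 0⟩ : GaussianInt) ∈ Ω → σ = 1) := by
    by_cases h : (⟨1, 0⟩ : GaussianInt) ∈ Ω
    · exact ⟨-1, Or.inr rfl, fun _ => rfl, fun h' => (hΩ.not_opposite_re ⟨h, h'⟩).elim⟩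
    · exact ⟨1, Or.inl rfl, fun h' => (h h').elim, fun _ => rfl⟩
  obtain ⟨τ, hτ, hτ1, hτ2⟩ : ∃ τ : ℝ, (τ = 1 ∨ τ = -1) ∧
      ((⟨0, 1⟩ : GaussianInt) ∈ Ω → τ = -1) ∧ ((⟨0, -1⟩ : GaussianInt) ∈ Ω → τ = 1) := by
    by_cases h : (⟨0, 1⟩ : GaussianInt) ∈ Ω
    · exact ⟨-1, Or.inr rfl, fun _ => rfl, fun h' => (hΩ.not_opposite_im ⟨h, h'⟩).elim⟩
    · exact ⟨1, Or.inl rfl, fun h' => (h h').elim, fun _ => rfl⟩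
  refine ⟨σ, τ, by rcases hσ with rfl | rfl <;> simp, by rcases hτ with rfl | rfl <;> simp, ?_⟩
  intro w a1 a2 a3 a4
  have c1 : |w.re| < 1 / 4 := by
    rw [abs_lt]; rcases hσ with rfl | rfl <;> constructor <;> linarith
  have c2 : |w.im| < 1 / 4 := by
    rw [abs_lt]; rcases hτ with rfl | rfl <;> constructor <;> linarith
  refine ⟨by linarith, by linarith, ?_⟩
  rintro ⟨p, q⟩ hω
  obtain ⟨b1, b1'⟩ := abs_le.1 (hΩ.abs_re_le _ hω)
  obtain ⟨b2, b2'⟩ := abs_le.1 (hΩ.abs_im_le _ hω)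
  simp only at b1 b1' b2 b2'
  rw [abs_lt] at c1 c2
  simp only
  interval_cases p <;> interval_cases q <;> push_cast
  · nlinarith
  · rw [hσ2 hω] at a1; nlinarith
  · nlinarith
  · rw [hτ2 hω] at a3; nlinarith
  · exact (hΩ.zero_notMem hω).elim
  · rw [hτ1 hω] at a3; nlinarith
  · nlinarith
  · rw [hσ1 hω] at a1; nlinarith
  · nlinarith

/-! ### Measurability and areas -/

instance : Countable GaussianInt :=
  Function.Injective.countable (f := fun a : GaussianInt => (a.re, a.im)) fun _ _ h =>
    Zsqrtd.ext (congrArg Prod.fst h) (congrArg Prod.snd h)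

theorem measurableSet_region (Ω : Set GaussianInt) : MeasurableSet (region Ω) := by
  have : region Ω = {w : ℂ | |w.re| < 1 / 2} ∩ ({w : ℂ | |w.im| < 1 / 2} ∩
      ⋂ ω ∈ Ω, {w : ℂ | 1 < (w.re - (ω.re : ℝ)) ^ 2 + (w.im - (ω.im : ℝ)) ^ 2}) := by
    ext w; simp [region]
  rw [this]
  refine (measurableSet_lt (by fun_prop) (by fun_prop)).inter
    ((measurableSet_lt (by fun_prop) (by fun_prop)).inter ?_)
  exact MeasurableSet.biInter (Set.to_countable Ω) fun ω _ =>
    measurableSet_lt (by fun_prop) (by fun_prop)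

theorem measurable_nearest : Measurable fun z : ℂ => (nearest z : ℂ) := by
  simp only [nearest, GaussianInt.toComplex_def']
  have h1 : Measurable fun z : ℂ => ((⌊z.re + 1 / 2⌋ : ℤ) : ℂ) :=
    (measurable_of_countable (fun n : ℤ => (n : ℂ))).comp
      (Int.measurable_floor.comp (by fun_prop))
  have h2 : Measurable fun z : ℂ => ((⌊z.im + 1 / 2⌋ : ℤ) : ℂ) :=
    (measurable_of_countable (fun n : ℤ => (n : ℂ))).comp
      (Int.measurable_floor.comp (by fun_prop))
  fun_prop

theorem measurableSet_nearest (P : GaussianInt → Prop) : MeasurableSet {z : ℂ | P (nearest z)} := by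
  have : {z : ℂ | P (nearest z)} =
      (fun z : ℂ => (nearest z : ℂ)) ⁻¹' ((fun a : GaussianInt => (a : ℂ)) '' {a | P a}) := by
    ext z
    simp [GaussianInt.toComplex_inj]
  rw [this]
  exact measurable_nearest ((Set.to_countable _).image _).measurableSet

theorem measurable_T : Measurable T := by
  unfold T
  exact Measurable.ite (measurableSet_singleton 0) measurable_const
    (measurable_inv.sub (measurable_nearest.comp measurable_inv))

theorem measurableSet_square : MeasurableSet square := measurableSet_nearest (· = 0)

theorem mem_square_iff {z : ℂ} :
    z ∈ square ↔ (-(1 / 2) ≤ z.re ∧ z.re < 1 / 2) ∧ -(1 / 2) ≤ z.im ∧ z.im < 1 / 2 := by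
  have : z ∈ square ↔ ⌊z.re + 1 / 2⌋ = 0 ∧ ⌊z.im + 1 / 2⌋ = 0 := by
    simp only [square, nearest, Set.mem_ofPred_eq, Zsqrtd.ext_iff, Zsqrtd.re_zero, Zsqrtd.im_zero]
  rw [this, Int.floor_eq_zero_iff, Int.floor_eq_zero_iff, Set.mem_Ico, Set.mem_Ico]
  constructor <;> rintro ⟨⟨h1, h2⟩, h3, h4⟩ <;> refine ⟨⟨?_, ?_⟩, ?_, ?_⟩ <;> linarith

theorem nearest_add (a : GaussianInt) (w : ℂ) : nearest (a + w) = a + nearest w := by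
  simp only [nearest, Complex.add_re, Complex.add_im, ← GaussianInt.intCast_re,
    ← GaussianInt.intCast_im, add_assoc, Int.floor_intCast_add]
  rfl

theorem nearest_eq_iff {a : GaussianInt} {z : ℂ} : nearest z = a ↔ z - a ∈ square := by
  have := nearest_add a (z - a)
  rw [add_sub_cancel] at this
  rw [this, square, Set.mem_ofPred_eq, add_eq_left]

theorem volume_rectangle (s t : Set ℝ) :
    volume {w : ℂ | w.re ∈ s ∧ w.im ∈ t} = volume s * volume t := by
  rw [← Measure.prod_prod, ← Measure.volume_eq_prod,
    ← Complex.volume_preserving_equiv_real_prod.measure_preimage_equiv]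
  rfl

theorem volume_square : volume square = 1 := by
  have : square = {w : ℂ | w.re ∈ Set.Ico (-(1 / 2) : ℝ) (1 / 2) ∧
      w.im ∈ Set.Ico (-(1 / 2) : ℝ) (1 / 2)} := by
    ext w; exact mem_square_iff
  rw [this, volume_rectangle, Real.volume_Ico]
  norm_num

/-- Almost every point of the half-open square is an interior point. -/
theorem square_ae_eq : square =ᵐ[volume] {w : ℂ | |w.re| < 1 / 2 ∧ |w.im| < 1 / 2} := by
  have h1 : volume {w : ℂ | w.re ∈ ({-(1 / 2)} : Set ℝ) ∧ w.im ∈ Set.univ} = 0 := by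
    rw [volume_rectangle]; simp
  have h2 : volume {w : ℂ | w.re ∈ Set.univ ∧ w.im ∈ ({-(1 / 2)} : Set ℝ)} = 0 := by
    rw [volume_rectangle]; simp
  have h : ∀ᵐ w : ℂ, w.re ≠ -(1 / 2) ∧ w.im ≠ -(1 / 2) := by
    rw [ae_iff]
    refine measure_mono_null ?_ (measure_union_null h1 h2)
    intro w hw
    simp only [Set.mem_ofPred_eq, not_and_or, not_not] at hw
    rcases hw with hw | hw
    · left; simpa using hw
    · right; simpa using hw
  filter_upwards [h] with w hw
  refine propext ?_
  change w ∈ square ↔ (|w.re| < 1 / 2 ∧ |w.im| < 1 / 2)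
  rw [mem_square_iff, abs_lt, abs_lt]
  constructor
  · rintro ⟨⟨a1, a2⟩, a3, a4⟩
    exact ⟨⟨lt_of_le_of_ne a1 (Ne.symm hw.1), a2⟩, lt_of_le_of_ne a3 (Ne.symm hw.2), a4⟩
  · rintro ⟨⟨a1, a2⟩, a3, a4⟩
    exact ⟨⟨a1.le, a2⟩, a3.le, a4⟩

/-! ### Change of variables and bounded distortion -/

/-- The weight `g` transported by the inverse branch `w ↦ 1 / (a + w)`. -/
def pull (a : GaussianInt) (g : ℂ → ℝ≥0∞) (w : ℂ) : ℝ≥0∞ :=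
  ENNReal.ofReal ((‖(a + w : ℂ)‖ ^ 4)⁻¹) * g (a + w : ℂ)⁻¹

/-- The points of `region Ω` with first digit `a` that `T` maps into `A`. -/
def cell (Ω : Set GaussianInt) (a : GaussianInt) (A : Set ℂ) : Set ℂ :=
  {z | z ∈ region Ω ∧ z ≠ 0 ∧ nearest z⁻¹ = a ∧ T z ∈ A}

theorem measurableSet_cell (Ω : Set GaussianInt) (a : GaussianInt) {A : Set ℂ}
    (hA : MeasurableSet A) : MeasurableSet (cell Ω a A) :=
  (measurableSet_region Ω).inter ((measurableSet_singleton (0 : ℂ)).compl.inter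
    ((measurable_inv (measurableSet_nearest (· = a))).inter (measurable_T hA)))

theorem setLIntegral_cell (Ω : Set GaussianInt) (a : GaussianInt) {A : Set ℂ}
    (hA : MeasurableSet A) (g : ℂ → ℝ≥0∞) :
    ∫⁻ z in cell Ω a A, g z = ∫⁻ w in branchDomain Ω a ∩ A, pull a g w := by
  set s : Set ℂ := square ∩ ({w | (a + w : ℂ) ≠ 0 ∧ (a + w : ℂ)⁻¹ ∈ region Ω} ∩ A) with hs
  have h : Measurable fun w : ℂ => (a + w : ℂ) := by fun_prop
  have hsm : MeasurableSet s := measurableSet_square.inter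
    (((h (measurableSet_singleton (0 : ℂ)).compl).inter (h.inv (measurableSet_region Ω))).inter hA)
  have himage : (fun w : ℂ => (a + w : ℂ)⁻¹) '' s = cell Ω a A := by
    ext z
    constructor
    · rintro ⟨w, ⟨h1, ⟨h2, h3⟩, h4⟩, rfl⟩
      have hn : nearest (a + w : ℂ) = a := by
        rw [nearest_eq_iff, add_sub_cancel_left]; exact h1
      refine ⟨h3, inv_ne_zero h2, by rw [inv_inv]; exact hn, ?_⟩
      rw [T, if_neg (inv_ne_zero h2), inv_inv, hn, add_sub_cancel_left]
      exact h4
    · rintro ⟨h1, h2, h3, h4⟩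
      rw [T, if_neg h2, h3] at h4
      refine ⟨z⁻¹ - a, ⟨nearest_eq_iff.1 h3, ?_, h4⟩, ?_⟩
      · simpa [h2] using h1
      · simp
  -- Digits are defined by the half-open square, `branchDomain` by the open one; the sides are null.
  have hae : s =ᵐ[volume] (branchDomain Ω a ∩ A : Set ℂ) := by
    have e : (branchDomain Ω a ∩ A : Set ℂ) = {w : ℂ | |w.re| < 1 / 2 ∧ |w.im| < 1 / 2} ∩
        ({w | (a + w : ℂ) ≠ 0 ∧ (a + w : ℂ)⁻¹ ∈ region Ω} ∩ A) := by
      ext w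
      simp only [branchDomain, Set.mem_inter_iff, Set.mem_ofPred_eq]
      tauto
    rw [e]
    exact square_ae_eq.inter (ae_eq_refl _)
  have hderiv : ∀ w ∈ s, HasFDerivWithinAt (fun w : ℂ => (a + w : ℂ)⁻¹)
      ((ContinuousLinearMap.toSpanSingleton ℂ (-1 / (a + w : ℂ) ^ 2)).restrictScalars ℝ) s w := by
    intro w hw
    have : HasDerivAt (fun w : ℂ => (a + w : ℂ)) 1 w := (hasDerivAt_id w).const_add _
    exact ((this.inv hw.2.1.1).hasFDerivAt.restrictScalars ℝ).hasFDerivWithinAt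
  have hinj : Set.InjOn (fun w : ℂ => (a + w : ℂ)⁻¹) s := fun w _ w' _ hww' =>
    add_left_cancel (inv_injective hww')
  rw [← himage, lintegral_image_eq_lintegral_abs_det_fderiv_mul volume hsm hderiv hinj,
    ← setLIntegral_congr hae]
  refine setLIntegral_congr_fun hsm fun w _ => ?_
  simp only [pull]
  congr 2
  have : ((ContinuousLinearMap.toSpanSingleton ℂ (-1 / (a + w : ℂ) ^ 2)).restrictScalars ℝ).det =
      Complex.normSq (-1 / (a + w : ℂ) ^ 2) := by
    simp [ContinuousLinearMap.det, LinearMap.det_restrictScalars, Algebra.norm_complex_eq]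
  rw [this, abs_of_nonneg (Complex.normSq_nonneg _), Complex.normSq_eq_norm_sq, norm_div, norm_neg,
    norm_one, norm_pow, div_pow, one_pow, ← pow_mul, one_div]

/-- The logarithm of `g` is Lipschitz on `region Ω`, with constant `8`. -/
def LogLip (Ω : Set GaussianInt) (g : ℂ → ℝ≥0∞) : Prop :=
  ∀ z ∈ region Ω, ∀ w ∈ region Ω, g z ≤ ENNReal.ofReal (Real.exp (8 * ‖z - w‖)) * g w

theorem logLip_one (Ω : Set GaussianInt) : LogLip Ω fun _ => 1 := by
  intro z _ w _
  rw [mul_one, ENNReal.one_le_ofReal]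
  exact Real.one_le_exp (by positivity)

theorem sq_two_lt_norm {Ω : Set GaussianInt} {a : GaussianInt} {w : ℂ}
    (hw : w ∈ branchDomain Ω a) : 2 < ‖(a + w : ℂ)‖ ^ 2 := by
  have := two_lt_normSq hw.2.2.1 hw.2.2.2
  rwa [← Complex.normSq_eq_norm_sq, Complex.normSq_apply, ← sq, ← sq]

/-- The constant 8 solves C = C/2 + 4: inverse branches contract by 1/2, since |a + w|² > 2, and the
Jacobian |a + w|⁻⁴ contributes 4. -/
theorem LogLip.pull_le {Ω : Set GaussianInt} {g : ℂ → ℝ≥0∞} (hg : LogLip Ω g) {a : GaussianInt}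
    {w w' : ℂ} (hw : w ∈ branchDomain Ω a) (hw' : w' ∈ branchDomain Ω a) :
    pull a g w ≤ ENNReal.ofReal (Real.exp (8 * ‖w - w'‖)) * pull a g w' := by
  have hn := sq_two_lt_norm hw
  have hn' := sq_two_lt_norm hw'
  set v : ℂ := a + w with hv
  set v' : ℂ := a + w' with hv'
  have hvv : w - w' = v - v' := by rw [hv, hv']; ring
  have v0 : v ≠ 0 := hw.2.2.1
  have v0' : v' ≠ 0 := hw'.2.2.1
  have p1 : 1 < ‖v‖ := by nlinarith [norm_nonneg v]
  have p1' : 1 < ‖v'‖ := by nlinarith [norm_nonneg v']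
  set d := ‖w - w'‖ with hd
  have hdist : ‖v⁻¹ - v'⁻¹‖ ≤ d / 2 := by
    have : v⁻¹ - v'⁻¹ = (v' - v) / (v * v') := by field_simp
    rw [this, norm_div, norm_mul, norm_sub_rev, ← hvv, ← hd]
    have : 2 ≤ ‖v‖ * ‖v'‖ := by
      by_contra! hlt
      have := mul_lt_mul'' hlt hlt (by positivity) (by positivity)
      nlinarith
    exact div_le_div_of_nonneg_left (norm_nonneg _) two_pos this
  have hratio : ‖v'‖ ≤ Real.exp d * ‖v‖ := by
    have h1 : ‖v'‖ ≤ ‖v‖ + d := by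
      rw [hd, hvv, norm_sub_rev]
      calc ‖v'‖ = ‖v + (v' - v)‖ := by rw [add_sub_cancel]
        _ ≤ _ := norm_add_le _ _
    have h2 : d + 1 ≤ Real.exp d := Real.add_one_le_exp d
    have : 0 ≤ d := norm_nonneg _
    nlinarith
  have hpow : (‖v‖ ^ 4)⁻¹ ≤ Real.exp (4 * d) * (‖v'‖ ^ 4)⁻¹ := by
    have := pow_le_pow_left₀ (norm_nonneg _) hratio 4
    rw [mul_pow, ← Real.exp_nat_mul] at this
    rw [← div_eq_mul_inv, le_div_iff₀ (by positivity), inv_mul_le_iff₀ (by positivity), mul_comm]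
    exact_mod_cast this
  have hgv := hg _ hw.2.2.2 _ hw'.2.2.2
  rw [← hv, ← hv'] at hgv
  simp only [pull, ← hv, ← hv']
  calc ENNReal.ofReal ((‖v‖ ^ 4)⁻¹) * g v⁻¹
      ≤ ENNReal.ofReal (Real.exp (4 * d) * (‖v'‖ ^ 4)⁻¹) *
          (ENNReal.ofReal (Real.exp (4 * d)) * g v'⁻¹) := by
        refine mul_le_mul' (ENNReal.ofReal_le_ofReal hpow) (hgv.trans ?_)
        exact mul_le_mul' (ENNReal.ofReal_le_ofReal (Real.exp_le_exp.2 (by linarith))) le_rfl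
    _ = ENNReal.ofReal (Real.exp (8 * d)) * (ENNReal.ofReal ((‖v'‖ ^ 4)⁻¹) * g v'⁻¹) := by
        have : Real.exp (8 * d) = Real.exp (4 * d) * Real.exp (4 * d) := by
          rw [← Real.exp_add]; ring_nf
        rw [this, ENNReal.ofReal_mul (Real.exp_nonneg _), ENNReal.ofReal_mul (Real.exp_nonneg _)]
        ring

/-! ### Multiplying conditional bounds -/

/-- The points whose first `N` digits satisfy the conditions `P 0, …, P (N - 1)`. -/
def digitEvent (P : ℕ → GaussianInt → Prop) (N : ℕ) : Set ℂ :=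
  {z | ∀ k < N, P k (nearest (T^[k] z)⁻¹)}

theorem measurableSet_digit (P : GaussianInt → Prop) (k : ℕ) :
    MeasurableSet {z : ℂ | P (nearest (T^[k] z)⁻¹)} :=
  (measurable_T.iterate k).inv (measurableSet_nearest P)

theorem measurableSet_digitEvent (P : ℕ → GaussianInt → Prop) (N : ℕ) :
    MeasurableSet (digitEvent P N) := by
  have : digitEvent P N = ⋂ k, ⋂ (_ : k < N), {z : ℂ | P k (nearest (T^[k] z)⁻¹)} := by
    ext; simp [digitEvent]
  rw [this]
  exact MeasurableSet.iInter fun k => MeasurableSet.iInter fun _ => measurableSet_digit _ k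

/-- Splitting by the first digit turns the remaining conditions into shifted ones on another
admissible region with another log-Lipschitz weight. Hence the induction must range over all `P`,
`θ`, `Ω` and `g`. -/
theorem setLIntegral_digitEvent_le (N : ℕ) :
    ∀ (P : ℕ → GaussianInt → Prop) (θ : ℕ → ℝ≥0∞),
      (∀ k Ω g, Admissible Ω → LogLip Ω g →
        ∫⁻ z in region Ω ∩ {z | P k (nearest z⁻¹)}, g z ≤ θ k * ∫⁻ z in region Ω, g z) →
      ∀ Ω g, Admissible Ω → LogLip Ω g →
        ∫⁻ z in region Ω ∩ digitEvent P N, g z ≤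
          (∏ k ∈ Finset.range N, θ k) * ∫⁻ z in region Ω, g z := by
  induction N with
  | zero =>
    intro P θ _ Ω g _ _
    simpa using lintegral_mono_set Set.inter_subset_left
  | succ N ih =>
    intro P θ hP Ω g hΩ hg
    set A := digitEvent (fun k => P (k + 1)) N with hA
    have hAm : MeasurableSet A := measurableSet_digitEvent _ _
    set Θ := ∏ k ∈ Finset.range N, θ (k + 1) with hΘ
    -- The point 0 has no first digit and lies in no cell, but it is null.
    have hsub : region Ω ∩ digitEvent P (N + 1) ⊆
        {0} ∪ ⋃ a : {a // P 0 a}, cell Ω a A := by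
      rintro z ⟨hz, hzP⟩
      by_cases hz0 : z = 0
      · exact Or.inl hz0
      · refine Or.inr (Set.mem_iUnion.2 ⟨⟨nearest z⁻¹, hzP 0 (Nat.succ_pos N)⟩, hz, hz0, rfl, ?_⟩)
        intro k hk
        simpa using hzP (k + 1) (Nat.succ_lt_succ hk)
    have hcell : ∀ a, ∫⁻ z in cell Ω a A, g z ≤ Θ * ∫⁻ z in cell Ω a Set.univ, g z := by
      intro a
      rw [setLIntegral_cell Ω a hAm, setLIntegral_cell Ω a MeasurableSet.univ, Set.inter_univ]
      rcases (branchDomain Ω a).eq_empty_or_nonempty with he | hne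
      · simp [he]
      · have hlip : LogLip (next Ω a) (pull a g) := by
          intro z hz w hw
          rw [← branchDomain_eq hΩ hne] at hz hw
          exact hg.pull_le hz hw
        rw [branchDomain_eq hΩ hne]
        exact ih _ (fun k => θ (k + 1)) (fun k => hP (k + 1)) _ _ (admissible_next hne) hlip
    have hdisj : Pairwise (Function.onFun Disjoint
        fun a : {a // P 0 a} => cell Ω a Set.univ) := by
      intro a b hab
      refine Set.disjoint_left.2 fun z hz hz' => hab (Subtype.ext ?_)
      exact hz.2.2.1.symm.trans hz'.2.2.1
    calc ∫⁻ z in region Ω ∩ digitEvent P (N + 1), g z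
        ≤ ∫⁻ z in {0} ∪ ⋃ a : {a // P 0 a}, cell Ω a A, g z := lintegral_mono_set hsub
      _ ≤ (∫⁻ z in {0}, g z) + ∫⁻ z in ⋃ a : {a // P 0 a}, cell Ω a A, g z :=
          lintegral_union_le _ _ _
      _ = ∫⁻ z in ⋃ a : {a // P 0 a}, cell Ω a A, g z := by
          rw [setLIntegral_measure_zero _ _ (measure_singleton 0), zero_add]
      _ ≤ ∑' a : {a // P 0 a}, ∫⁻ z in cell Ω a A, g z := lintegral_iUnion_le _ _
      _ ≤ ∑' a : {a // P 0 a}, Θ * ∫⁻ z in cell Ω a Set.univ, g z :=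
          ENNReal.tsum_le_tsum fun a => hcell a
      _ = Θ * ∫⁻ z in ⋃ a : {a // P 0 a}, cell Ω a Set.univ, g z := by
          rw [ENNReal.tsum_mul_left, lintegral_iUnion
            (fun a : {a // P 0 a} => measurableSet_cell Ω a MeasurableSet.univ) hdisj]
      _ ≤ Θ * ∫⁻ z in region Ω ∩ {z | P 0 (nearest z⁻¹)}, g z := by
          refine mul_le_mul' le_rfl (lintegral_mono_set (Set.iUnion_subset fun a z hz => ?_))
          refine ⟨hz.1, ?_⟩
          change P 0 (nearest z⁻¹)
          rw [hz.2.2.1]; exact a.2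
      _ ≤ Θ * (θ 0 * ∫⁻ z in region Ω, g z) := by
          gcongr
          exact hP 0 Ω g hΩ hg
      _ = (∏ k ∈ Finset.range (N + 1), θ k) * ∫⁻ z in region Ω, g z := by
          rw [Finset.prod_range_succ', mul_assoc]

/-! ### Probability of a large first digit -/

theorem norm_sub_nearest_le (z : ℂ) : ‖z - nearest z‖ ≤ 1 := by
  obtain ⟨⟨h1, h2⟩, h3, h4⟩ := mem_square_iff.1 (nearest_eq_iff.1 (rfl : nearest z = nearest z))
  have a1 := abs_le.2 ⟨h1, h2.le⟩
  have a2 := abs_le.2 ⟨h3, h4.le⟩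
  linarith [Complex.norm_le_abs_re_add_abs_im (z - nearest z)]

theorem norm_sub_le_of_mem_region {Ω : Set GaussianInt} {z w : ℂ} (hz : z ∈ region Ω)
    (hw : w ∈ region Ω) : ‖z - w‖ ≤ 2 := by
  have h1 := Complex.norm_le_abs_re_add_abs_im z
  have h2 := Complex.norm_le_abs_re_add_abs_im w
  linarith [norm_sub_le z w, hz.1, hz.2.1, hw.1, hw.2.1]

/-- On subsets of a region, the masses of a log-Lipschitz weight are comparable to the areas. -/
theorem LogLip.volume_mul_lintegral_le {Ω : Set GaussianInt} {g : ℂ → ℝ≥0∞} (hg : LogLip Ω g)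
    {B D : Set ℂ} (hBm : MeasurableSet B) (hDm : MeasurableSet D) (hB : B ⊆ region Ω)
    (hD : D ⊆ region Ω) (hfin : volume B ≠ ∞) :
    (∫⁻ z in D, g z) * volume B ≤ ENNReal.ofReal (Real.exp 16) * (∫⁻ z in B, g z) * volume D := by
  -- The exponent 16 is the Lipschitz constant 8 times the diameter bound 2.
  have key : ∀ z ∈ D, g z * volume B ≤ ENNReal.ofReal (Real.exp 16) * ∫⁻ w in B, g w := by
    intro z hz
    rw [← setLIntegral_const, ← lintegral_const_mul' _ _ ENNReal.ofReal_ne_top]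
    refine setLIntegral_mono' hBm fun w hw => (hg z (hD hz) w (hB hw)).trans ?_
    refine mul_le_mul' (ENNReal.ofReal_le_ofReal (Real.exp_le_exp.2 ?_)) le_rfl
    linarith [norm_sub_le_of_mem_region (hD hz) (hB hw)]
  rw [← lintegral_mul_const' _ _ hfin, ← setLIntegral_const]
  exact setLIntegral_mono' hDm key

theorem volume_signed_interval {σ : ℝ} (hσ : |σ| = 1) (r : ℝ) :
    volume {x : ℝ | 0 < σ * x ∧ σ * x < r} = ENNReal.ofReal r := by
  rcases eq_or_eq_neg_of_abs_eq hσ with rfl | rfl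
  · have : {x : ℝ | 0 < 1 * x ∧ 1 * x < r} = Set.Ioo 0 r := by ext; simp
    rw [this, Real.volume_Ioo, sub_zero]
  · have : {x : ℝ | 0 < -1 * x ∧ -1 * x < r} = Set.Ioo (-r) 0 := by
      ext x
      simp only [Set.mem_ofPred_eq, Set.mem_Ioo]
      constructor <;> rintro ⟨h1, h2⟩ <;> constructor <;> linarith
    rw [this, Real.volume_Ioo, zero_sub, neg_neg]

theorem exists_subset_region_near_zero {Ω : Set GaussianInt} (hΩ : Admissible Ω) {r : ℝ}
    (hr : 0 < r) (hr' : r ≤ 1 / 4) :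
    ∃ B ⊆ region Ω, MeasurableSet B ∧ volume B = ENNReal.ofReal (r ^ 2) ∧
      ∀ z ∈ B, z ≠ 0 ∧ ‖z‖ ≤ 2 * r := by
  obtain ⟨σ, τ, hσ, hτ, h⟩ := exists_corner_subset_region hΩ
  refine ⟨{w : ℂ | w.re ∈ {x : ℝ | 0 < σ * x ∧ σ * x < r} ∧
    w.im ∈ {x : ℝ | 0 < τ * x ∧ τ * x < r}}, ?_, ?_, ?_, ?_⟩
  · rintro w ⟨⟨h1, h2⟩, h3, h4⟩
    exact h w h1 (by linarith) h3 (by linarith)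
  · have hm : ∀ s : ℝ, MeasurableSet {x : ℝ | 0 < s * x ∧ s * x < r} := fun s =>
      (measurableSet_lt (f := fun _ : ℝ => (0 : ℝ)) (g := fun x => s * x)
        (by fun_prop) (by fun_prop)).inter
        (measurableSet_lt (f := fun x : ℝ => s * x) (g := fun _ => r) (by fun_prop) (by fun_prop))
    exact (Complex.measurable_re (hm σ)).inter (Complex.measurable_im (hm τ))
  · rw [volume_rectangle, volume_signed_interval hσ, volume_signed_interval hτ,
      ← ENNReal.ofReal_mul hr.le, sq]
  · rintro w ⟨⟨h1, h2⟩, h3, h4⟩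
    have e1 : |w.re| = σ * w.re := by rw [← abs_of_pos h1, abs_mul, hσ, one_mul]
    have e2 : |w.im| = τ * w.im := by rw [← abs_of_pos h3, abs_mul, hτ, one_mul]
    refine ⟨?_, ?_⟩
    · rintro rfl
      simp at h1
    · linarith [Complex.norm_le_abs_re_add_abs_im w]

theorem volume_region_le_one (Ω : Set GaussianInt) : volume (region Ω) ≤ 1 := by
  rw [← volume_square]
  refine measure_mono fun w hw => mem_square_iff.2 ?_
  have h1 := abs_lt.1 hw.1
  have h2 := abs_lt.1 hw.2.1
  exact ⟨⟨h1.1.le, h1.2⟩, h2.1.le, h2.2⟩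

/-- The first digit is at least `u` on a proportion at least `const / u²` of each region. -/
theorem LogLip.le_lintegral_large_digit {Ω : Set GaussianInt} {g : ℂ → ℝ≥0∞} (hΩ : Admissible Ω)
    (hg : LogLip Ω g) {u : ℝ} (hu : 1 ≤ u) :
    ENNReal.ofReal (Real.exp (-16) / 16 * (u ^ 2)⁻¹) * ∫⁻ z in region Ω, g z ≤
      ∫⁻ z in region Ω ∩ {z | u ≤ ‖(nearest z⁻¹ : ℂ)‖}, g z := by
  have hu0 : 0 < u := by linarith
  have hr : 1 / (4 * u) ≤ 1 / 4 := by
    rw [div_le_div_iff₀ (by positivity) (by positivity)]; linarith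
  -- With this side, |1/z| ≥ 2u on `B`; rounding costs at most 1 ≤ u.
  obtain ⟨B, hB, hBm, hBv, hBz⟩ :=
    exists_subset_region_near_zero hΩ (r := 1 / (4 * u)) (by positivity) hr
  have hsub : B ⊆ region Ω ∩ {z | u ≤ ‖(nearest z⁻¹ : ℂ)‖} := by
    intro z hz
    refine ⟨hB hz, ?_⟩
    obtain ⟨hz0, hzn⟩ := hBz z hz
    have hpos : 0 < ‖z‖ := norm_pos_iff.2 hz0
    have h1 : 2 * u ≤ ‖z⁻¹‖ := by
      rw [norm_inv, le_inv_comm₀ (by positivity) hpos]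
      refine hzn.trans (le_of_eq ?_)
      field_simp
      norm_num
    have h2 := norm_sub_nearest_le z⁻¹
    have h3 := norm_sub_norm_le z⁻¹ (nearest z⁻¹ : ℂ)
    change u ≤ ‖(nearest z⁻¹ : ℂ)‖
    linarith
  have hcmp := hg.volume_mul_lintegral_le hBm (measurableSet_region Ω) hB subset_rfl
    (by rw [hBv]; exact ENNReal.ofReal_ne_top)
  rw [hBv] at hcmp
  have hconst : Real.exp (-16) / 16 * (u ^ 2)⁻¹ = Real.exp (-16) * (1 / (4 * u)) ^ 2 := by
    field_simp
    norm_num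
  calc ENNReal.ofReal (Real.exp (-16) / 16 * (u ^ 2)⁻¹) * ∫⁻ z in region Ω, g z
      = ENNReal.ofReal (Real.exp (-16)) *
          ((∫⁻ z in region Ω, g z) * ENNReal.ofReal ((1 / (4 * u)) ^ 2)) := by
        rw [hconst, ENNReal.ofReal_mul (Real.exp_nonneg _)]; ring
    _ ≤ ENNReal.ofReal (Real.exp (-16)) *
          (ENNReal.ofReal (Real.exp 16) * (∫⁻ z in B, g z) * 1) :=
        mul_le_mul' le_rfl (hcmp.trans (mul_le_mul' le_rfl (volume_region_le_one Ω)))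
    _ = ∫⁻ z in B, g z := by
        rw [mul_one, ← mul_assoc, ← ENNReal.ofReal_mul (Real.exp_nonneg _), ← Real.exp_add]
        simp
    _ ≤ _ := lintegral_mono_set hsub

/-- The first digit is at least `u` on a proportion at most `const / u²` of each region. -/
theorem LogLip.lintegral_large_digit_le {Ω : Set GaussianInt} {g : ℂ → ℝ≥0∞} (hΩ : Admissible Ω)
    (hg : LogLip Ω g) {u : ℝ} (hu : 0 < u) :
    ∫⁻ z in region Ω ∩ {z | u ≤ ‖(nearest z⁻¹ : ℂ)‖}, g z ≤
      ENNReal.ofReal (256 * Real.exp 16 * (u ^ 2)⁻¹) * ∫⁻ z in region Ω, g z := by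
  have hexp : 1 ≤ Real.exp 16 := Real.one_le_exp (by norm_num)
  -- For u < 2 the factor exceeds 1. For u ≥ 2 a digit of modulus at least u forces |1/z| ≥ u - 1 ≥
  -- u/2.
  rcases lt_or_ge u 2 with hu2 | hu2
  · refine (lintegral_mono_set Set.inter_subset_left).trans (le_mul_of_one_le_left' ?_)
    rw [ENNReal.one_le_ofReal, ← div_eq_mul_inv, le_div_iff₀ (by positivity)]
    nlinarith
  set D := region Ω ∩ {z | u ≤ ‖(nearest z⁻¹ : ℂ)‖} with hD
  have hDm : MeasurableSet D := (measurableSet_region Ω).inter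
    (measurable_inv (measurableSet_nearest fun a => u ≤ ‖(a : ℂ)‖))
  have hDv : volume D ≤ ENNReal.ofReal (16 * (u ^ 2)⁻¹) := by
    have hsub : D ⊆ {w : ℂ | w.re ∈ Set.Icc (-(2 / u)) (2 / u) ∧
        w.im ∈ Set.Icc (-(2 / u)) (2 / u)} := by
      rintro z ⟨-, hz⟩
      change u ≤ ‖(nearest z⁻¹ : ℂ)‖ at hz
      have h2 := norm_sub_nearest_le z⁻¹
      have h3 := norm_sub_norm_le (nearest z⁻¹ : ℂ) z⁻¹
      rw [norm_sub_rev] at h3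
      have h4 : u / 2 ≤ ‖z⁻¹‖ := by linarith
      have hz0 : 0 < ‖z‖ := by
        rw [norm_pos_iff]
        rintro rfl
        simp at h4
        linarith
      have h5 : ‖z‖ ≤ 2 / u := by
        rw [norm_inv, le_inv_comm₀ (by positivity) hz0, inv_div] at h4
        exact h4
      exact ⟨abs_le.1 ((Complex.abs_re_le_norm z).trans h5),
        abs_le.1 ((Complex.abs_im_le_norm z).trans h5)⟩
    refine (measure_mono hsub).trans (le_of_eq ?_)
    rw [volume_rectangle, Real.volume_Icc, ← ENNReal.ofReal_mul (by
      rw [sub_neg_eq_add]; positivity)]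
    congr 1
    field_simp
    norm_num
  have hRv : ENNReal.ofReal (1 / 16) ≤ volume (region Ω) := by
    obtain ⟨B, hB, -, hBv, -⟩ :=
      exists_subset_region_near_zero hΩ (r := 1 / 4) (by norm_num) le_rfl
    refine le_trans (le_of_eq ?_) (measure_mono hB)
    rw [hBv]
    norm_num
  have hcmp := hg.volume_mul_lintegral_le (measurableSet_region Ω) hDm subset_rfl
    Set.inter_subset_left (ne_top_of_le_ne_top ENNReal.one_ne_top (volume_region_le_one Ω))
  calc ∫⁻ z in D, g z
      = ENNReal.ofReal 16 * ((∫⁻ z in D, g z) * ENNReal.ofReal (1 / 16)) := by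
        rw [mul_left_comm, ← ENNReal.ofReal_mul (by norm_num)]
        norm_num
    _ ≤ ENNReal.ofReal 16 * (ENNReal.ofReal (Real.exp 16) * (∫⁻ z in region Ω, g z) *
          ENNReal.ofReal (16 * (u ^ 2)⁻¹)) :=
        mul_le_mul' le_rfl (((mul_le_mul' le_rfl hRv).trans hcmp).trans (mul_le_mul' le_rfl hDv))
    _ = ENNReal.ofReal (256 * Real.exp 16 * (u ^ 2)⁻¹) * ∫⁻ z in region Ω, g z := by
        have : 256 * Real.exp 16 * (u ^ 2)⁻¹ = 16 * (Real.exp 16 * (16 * (u ^ 2)⁻¹)) := by ring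
        rw [this]
        generalize 16 * (u ^ 2)⁻¹ = x
        rw [ENNReal.ofReal_mul (by norm_num), ENNReal.ofReal_mul (Real.exp_nonneg _)]
        ring

/-- The complement has proportion at most 1 - x ≤ exp(-x); the exponential form makes products into
sums. -/
theorem LogLip.lintegral_small_digit_le {Ω : Set GaussianInt} {g : ℂ → ℝ≥0∞} (hΩ : Admissible Ω)
    (hg : LogLip Ω g) {u : ℝ} (hu : 1 ≤ u) :
    ∫⁻ z in region Ω ∩ {z | ‖(nearest z⁻¹ : ℂ)‖ < u}, g z ≤
      ENNReal.ofReal (Real.exp (-(Real.exp (-16) / 16 * (u ^ 2)⁻¹))) *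
        ∫⁻ z in region Ω, g z := by
  set x := Real.exp (-16) / 16 * (u ^ 2)⁻¹ with hx
  have hx0 : 0 ≤ x := by positivity
  have hx1 : x ≤ 1 := by
    have h1 : Real.exp (-16) ≤ 1 := Real.exp_le_one_iff.2 (by norm_num)
    have h2 : (u ^ 2)⁻¹ ≤ 1 := inv_le_one_of_one_le₀ (by nlinarith)
    have h3 : 0 ≤ (u ^ 2)⁻¹ := by positivity
    nlinarith [Real.exp_nonneg (-16)]
  -- Weights need not be integrable, and passing to the complement cancels a finite mass.
  by_cases htop : ∫⁻ z in region Ω, g z = ∞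
  · rw [htop, ENNReal.mul_top (by simp [Real.exp_pos])]
    exact le_top
  have hlow := hg.le_lintegral_large_digit hΩ hu
  have hSm : MeasurableSet {z : ℂ | u ≤ ‖(nearest z⁻¹ : ℂ)‖} :=
    measurable_inv (measurableSet_nearest fun a => u ≤ ‖(a : ℂ)‖)
  have hsplit := lintegral_inter_add_sdiff (μ := volume) g (region Ω) hSm
  have hdiff : region Ω \ {z : ℂ | u ≤ ‖(nearest z⁻¹ : ℂ)‖} =
      region Ω ∩ {z | ‖(nearest z⁻¹ : ℂ)‖ < u} := by
    ext z; simp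
  rw [hdiff] at hsplit
  rw [← hx] at hlow
  have hsum : ENNReal.ofReal (1 - x) + ENNReal.ofReal x = 1 := by
    rw [← ENNReal.ofReal_add (by linarith) hx0]; simp
  have hle : ∫⁻ z in region Ω ∩ {z | ‖(nearest z⁻¹ : ℂ)‖ < u}, g z ≤
      ENNReal.ofReal (1 - x) * ∫⁻ z in region Ω, g z := by
    have hfin : ENNReal.ofReal x * ∫⁻ z in region Ω, g z ≠ ∞ :=
      ENNReal.mul_ne_top ENNReal.ofReal_ne_top htop
    rw [← ENNReal.add_le_add_iff_right hfin, ← add_mul, hsum, one_mul, add_comm]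
    exact (add_le_add_left hlow _).trans_eq hsplit
  refine hle.trans (mul_le_mul' (ENNReal.ofReal_le_ofReal ?_) le_rfl)
  linarith [Real.add_one_le_exp (-x)]

/-! ### The limsup set and the two Borel–Cantelli halves -/

theorem square_ae_eq_region : square =ᵐ[volume] region ∅ := by
  have : region ∅ = {w : ℂ | |w.re| < 1 / 2 ∧ |w.im| < 1 / 2} := by
    ext w; simp [region]
  rw [this]
  exact square_ae_eq

/-- A missing digit is recorded by `digit` as `0`, so it does not satisfy a positive lower
bound. -/
theorem mem_E_iff {u : ℕ+ → ℝ} (hu : ∀ n, 0 < u n) {z : ℂ} :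
    z ∈ E u ↔ z ∈ square ∧
      ∃ᶠ k : ℕ in atTop, u k.succPNat ≤ ‖(nearest (T^[k] z)⁻¹ : ℂ)‖ := by
  refine and_congr_right fun hz => ?_
  have hz0 : nearest z = 0 := hz
  have hset : {n : ℕ+ | HasDigit z n ∧ u n ≤ ‖(digit z n : ℂ)‖} =
      Nat.succPNat '' {k : ℕ | u k.succPNat ≤ ‖(nearest (T^[k] z)⁻¹ : ℂ)‖} := by
    ext n
    obtain ⟨k, rfl⟩ : ∃ k : ℕ, k.succPNat = n := ⟨n.natPred, PNat.succPNat_natPred n⟩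
    rw [Nat.succPNat_injective.mem_set_image]
    have hr : remainder z k = T^[k] z := by rw [remainder, hz0]; simp
    simp only [Set.mem_ofPred_eq, Nat.succPNat_coe, Nat.succ_eq_add_one, HasDigit, digit, hr]
    refine ⟨fun h => h.2, fun h => ⟨fun h0 => ?_, h⟩⟩
    have hn : nearest 0 = 0 := by
      have := mem_square_iff (z := 0)
      simp only [Complex.zero_re, Complex.zero_im] at this
      exact this.2 (by norm_num)
    rw [h0, inv_zero, hn, map_zero, norm_zero] at h
    exact (hu _).not_ge h
  rw [hset, Set.infinite_image_iff Nat.succPNat_injective.injOn, Nat.frequently_atTop_iff_infinite]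

theorem measurableSet_frequently_large_digit (v : ℕ → ℝ) :
    MeasurableSet {z : ℂ | ∃ᶠ k : ℕ in atTop, v k ≤ ‖(nearest (T^[k] z)⁻¹ : ℂ)‖} := by
  have : {z : ℂ | ∃ᶠ k : ℕ in atTop, v k ≤ ‖(nearest (T^[k] z)⁻¹ : ℂ)‖} =
      limsup (fun k => {z : ℂ | v k ≤ ‖(nearest (T^[k] z)⁻¹ : ℂ)‖}) atTop := by
    ext z
    rw [mem_limsup_iff_frequently_mem]
    rfl
  rw [this]
  exact MeasurableSet.measurableSet_limsup fun k => measurableSet_digit (fun a => v k ≤ ‖(a : ℂ)‖) k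

/-- Only the condition at `k` is active; every earlier digit is free and contributes a factor 1, so
no invariant measure is needed. -/
theorem volume_large_digit_le {u : ℝ} (hu : 0 < u) (k : ℕ) :
    volume (region ∅ ∩ {z : ℂ | u ≤ ‖(nearest (T^[k] z)⁻¹ : ℂ)‖}) ≤
      ENNReal.ofReal (256 * Real.exp 16 * (u ^ 2)⁻¹) := by
  have h := setLIntegral_digitEvent_le (k + 1) (fun j a => j = k → u ≤ ‖(a : ℂ)‖)
    (fun j => if j = k then ENNReal.ofReal (256 * Real.exp 16 * (u ^ 2)⁻¹) else 1)
    (by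
      intro j Ω g hΩ hg
      by_cases hj : j = k
      · simpa [hj] using hg.lintegral_large_digit_le hΩ hu
      · rw [if_neg hj, one_mul]
        exact lintegral_mono_set Set.inter_subset_left)
    ∅ (fun _ => 1) admissible_empty (logLip_one ∅)
  rw [Finset.prod_ite_eq' , if_pos (Finset.self_mem_range_succ k), setLIntegral_one,
    setLIntegral_one] at h
  calc _ ≤ _ := measure_mono (Set.inter_subset_inter_right _ ?_)
    _ ≤ _ := h
    _ ≤ _ := mul_le_of_le_one_right' (volume_region_le_one ∅)
  rintro z hz j - rfl
  exact hz

theorem volume_frequently_large_digit_eq_zero {v : ℕ → ℝ} (hv : ∀ k, 0 < v k)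
    (hsum : Summable fun k => (v k ^ 2)⁻¹) :
    volume (square ∩ {z : ℂ | ∃ᶠ k : ℕ in atTop, v k ≤ ‖(nearest (T^[k] z)⁻¹ : ℂ)‖}) = 0 := by
  set F := {z : ℂ | ∃ᶠ k : ℕ in atTop, v k ≤ ‖(nearest (T^[k] z)⁻¹ : ℂ)‖} with hF
  have hae : (square ∩ F : Set ℂ) =ᵐ[volume] (region ∅ ∩ F : Set ℂ) :=
    square_ae_eq_region.inter (ae_eq_refl F)
  rw [measure_congr hae, Set.inter_comm, hF,
    ← Measure.restrict_apply (measurableSet_frequently_large_digit v)]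
  refine measure_setOfPred_frequently_eq_zero
    (ne_top_of_le_ne_top (hsum.mul_left (256 * Real.exp 16)).tsum_ofReal_ne_top
      (ENNReal.tsum_le_tsum fun k => ?_))
  rw [Measure.restrict_apply (measurableSet_digit (fun a => v k ≤ ‖(a : ℂ)‖) k), Set.inter_comm]
  exact volume_large_digit_le (hv k) k

/-- The first `N` conditions have probability at most the exponential of minus a partial sum of a
divergent series. -/
theorem volume_eventually_small_digit_eq_zero {v : ℕ → ℝ} (hv : ∀ k, 1 ≤ v k)
    (hsum : ¬ Summable fun k => (v k ^ 2)⁻¹) (m : ℕ) :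
    volume (region ∅ ∩ {z : ℂ | ∀ k ≥ m, ‖(nearest (T^[k] z)⁻¹ : ℂ)‖ < v k}) = 0 := by
  set c := Real.exp (-16) / 16 with hc
  have hc0 : 0 < c := by positivity
  -- Digits before `m` are unconstrained, so their exponent is 0.
  set y : ℕ → ℝ := fun k => if m ≤ k then c * (v k ^ 2)⁻¹ else 0 with hy
  have hy0 : ∀ k, 0 ≤ y k := fun k => by
    simp only [hy]; split_ifs <;> positivity
  have hysum : ¬ Summable y := by
    intro h
    apply hsum
    have h1 : Summable fun k => c * (v k ^ 2)⁻¹ :=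
      (summable_congr_atTop (by
        filter_upwards [eventually_ge_atTop m] with k hk
        simp [hy, hk])).1 h
    exact (summable_mul_left_iff hc0.ne').1 h1
  have hdiv := (not_summable_iff_tendsto_nat_atTop_of_nonneg hy0).1 hysum
  have hbound : ∀ N, volume (region ∅ ∩ {z : ℂ | ∀ k ≥ m, ‖(nearest (T^[k] z)⁻¹ : ℂ)‖ < v k}) ≤
      ENNReal.ofReal (Real.exp (-∑ k ∈ Finset.range N, y k)) := by
    intro N
    have h := setLIntegral_digitEvent_le N (fun k a => m ≤ k → ‖(a : ℂ)‖ < v k)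
      (fun k => ENNReal.ofReal (Real.exp (-y k)))
      (by
        intro k Ω g hΩ hg
        by_cases hk : m ≤ k
        · simpa [hk, hy] using hg.lintegral_small_digit_le hΩ (hv k)
        · simp [hk, hy])
      ∅ (fun _ => 1) admissible_empty (logLip_one ∅)
    rw [← ENNReal.ofReal_prod_of_nonneg (fun k _ => Real.exp_nonneg _), ← Real.exp_sum,
      Finset.sum_neg_distrib, setLIntegral_one, setLIntegral_one] at h
    calc _ ≤ _ := measure_mono (Set.inter_subset_inter_right _ ?_)
      _ ≤ _ := h
      _ ≤ _ := mul_le_of_le_one_right' (volume_region_le_one ∅)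
    exact fun z hz k _ hk => hz k hk
  have hlim : Tendsto (fun N => ENNReal.ofReal (Real.exp (-∑ k ∈ Finset.range N, y k)))
      atTop (𝓝 0) := by
    have := ENNReal.tendsto_ofReal (Real.tendsto_exp_neg_atTop_nhds_zero.comp hdiv)
    rwa [ENNReal.ofReal_zero] at this
  exact le_antisymm (ge_of_tendsto' hlim hbound) zero_le

/-- Truncation from below at `1` preserves the divergence of `∑ v⁻²`. -/
theorem not_summable_max_one {v : ℕ → ℝ} (hsum : ¬ Summable fun k => (v k ^ 2)⁻¹) :
    ¬ Summable fun k => (max (v k) 1 ^ 2)⁻¹ := by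
  intro h
  apply hsum
  have hev : ∀ᶠ k in atTop, (max (v k) 1 ^ 2)⁻¹ < 1 :=
    h.tendsto_atTop_zero.eventually_lt_const one_pos
  refine (summable_congr_atTop ?_).1 h
  filter_upwards [hev] with k hk
  rcases le_total (v k) 1 with h1 | h1
  · rw [max_eq_right h1] at hk
    norm_num at hk
  · rw [max_eq_left h1]

/-- Raising the thresholds to at least 1 only enlarges the event of eventually small digits, which
is still null. -/
theorem volume_frequently_large_digit_eq_one {v : ℕ → ℝ}
    (hsum : ¬ Summable fun k => (v k ^ 2)⁻¹) :
    volume (square ∩ {z : ℂ | ∃ᶠ k : ℕ in atTop, v k ≤ ‖(nearest (T^[k] z)⁻¹ : ℂ)‖}) = 1 := by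
  set F := {z : ℂ | ∃ᶠ k : ℕ in atTop, v k ≤ ‖(nearest (T^[k] z)⁻¹ : ℂ)‖} with hF
  have hae : (square \ F : Set ℂ) =ᵐ[volume] (region ∅ \ F : Set ℂ) :=
    square_ae_eq_region.diff (ae_eq_refl F)
  rw [← volume_square]
  refine measure_inter_conull' ?_
  have hnull := measure_iUnion_null fun m => volume_eventually_small_digit_eq_zero
    (v := fun k => max (v k) 1) (fun k => le_max_right _ _) (not_summable_max_one hsum) m
  rw [measure_congr hae]
  refine measure_mono_null ?_ hnull
  rintro z ⟨hz, hzf⟩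
  simp only [hF, Set.mem_ofPred_eq, not_frequently, not_le, eventually_atTop] at hzf
  obtain ⟨m, hm⟩ := hzf
  exact Set.mem_iUnion.2 ⟨m, hz, fun k hk => (hm k hk).trans_le (le_max_left _ _)⟩

end

end HurwitzCF

theorem theorem1p2 (u : ℕ+ → ℝ) (hu : ∀ n, 0 < u n) :
    MeasurableSet (HurwitzCF.E u) ∧
      (Summable (fun n : ℕ+ => (u n ^ 2)⁻¹) →
        MeasureTheory.volume (HurwitzCF.E u) = 0) ∧
      (¬ Summable (fun n : ℕ+ => (u n ^ 2)⁻¹) →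
        MeasureTheory.volume (HurwitzCF.E u) = 1) := by
  have hE : HurwitzCF.E u = HurwitzCF.square ∩ {z : ℂ | ∃ᶠ k : ℕ in Filter.atTop,
      u k.succPNat ≤ ‖(HurwitzCF.nearest (HurwitzCF.T^[k] z)⁻¹ : ℂ)‖} :=
    Set.ext fun z => HurwitzCF.mem_E_iff hu
  have hsum : Summable (fun k : ℕ => (u k.succPNat ^ 2)⁻¹) ↔
      Summable (fun n : ℕ+ => (u n ^ 2)⁻¹) :=
    Equiv.pnatEquivNat.symm.summable_iff (f := fun n : ℕ+ => (u n ^ 2)⁻¹)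
  rw [hE]
  refine ⟨HurwitzCF.measurableSet_square.inter
    (HurwitzCF.measurableSet_frequently_large_digit fun k => u k.succPNat), fun h => ?_, fun h => ?_⟩
  · exact HurwitzCF.volume_frequently_large_digit_eq_zero (fun k => hu _) (hsum.2 h)
  · exact HurwitzCF.volume_frequently_large_digit_eq_one fun h' => h (hsum.1 h')
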